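/- Let $X$ be a nonempty compact metric space and $f:X\to X$ a continuous map. Let $\mathcal M_f(X)$ be the set of $f$-invariant Borel probability measures with the weak$^*$ topology, let $h_\mu(f)\in[0,\infty]$ be the metric (Kolmogorov–Sinai) entropy of $\mu\in\mathcal M_f(X)$, let $h_{\mathrm{top}}(f,Y)\in[0,\infty]$ be the topological entropy of a subset $Y\subset X$ in the sense of Bowen, and write $h_{\mathrm{top}}(f)=h_{\mathrm{top}}(f,X)$. Assume: 1. the entropy map $\mu\mapsto h_\mu(f)$ is upper semicontinuous on $\mathcal M_f(X)$; 2. $(X,f)$ has the saturated property for every invariant measure: for every $\mu\in\mathcal M_f(X)$ the set $G_\mu=\{x\in X:\frac1n\sum_{k=0}^{n-1}\delta_{f^kx}\to\mu\text{ weak}^*\}$ is nonempty and $h_{\mathrm{top}}(f,G_\mu)=h_\mu(f)$. For a continuous function $\varphi:X\to\mathbb R$ and $\alpha\in\mathbb R$ put $$L(\varphi,\alpha)=\Bigl\{x\in X:\lim_{n\to\infty}\tfrac1n\sum_{k=0}^{n-1}\varphi(f^kx)=\alpha\Bigr\},\qquad R(\varphi)=\{\alpha\in\mathbb R: L(\varphi,\alpha)\neq\emptyset\}.$$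 Then for every continuous $\varphi:X\to\mathbb R$ the set $R(\varphi)$ is a nonempty compact interval (possibly a single point), and the map $\alpha\mapsto h_{\mathrm{top}}(f,L(\varphi,\alpha))$ is continuous and concave on $R(\varphi)$ (as a map into $[0,\infty]$). If moreover there is exactly one measure of maximal entropy $m_{\max}$, that is, exactly one $m\in\mathcal M_f(X)$ with $h_m(f)=h_{\mathrm{top}}(f)$, then $\alpha_*=\int\varphi\,dm_{\max}$ belongs to $R(\varphi)$, $h_{\mathrm{top}}(f,L(\varphi,\alpha_*))=h_{\mathrm{top}}(f)$, and $h_{\mathrm{top}}(f,L(\varphi,\alpha))<h_{\mathrm{top}}(f)$ for every $\alpha\in R(\varphi)$ with $\alpha\neq\alpha_*$. -/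

import Mathlib

open Set Filter Topology MeasureTheory
open scoped NNReal ENNReal

noncomputable section

/-! ### Topological entropy of subsets in the sense of Bowen -/

/-- The number of consecutive iterates `E, f(E), f²(E), …` of the set `E` each of which lies in
some member of the cover `𝒜`: the largest `n` such that `f^k(E)` lies in a member of `𝒜` for
every `0 ≤ k < n`, and `⊤` if there is no largest one. -/
def bowenTime {X : Type*} (f : X → X) (𝒜 : Set (Set X)) (E : Set X) : ℕ∞ :=
  ⨆ (n : ℕ) (_ : ∀ k < n, ∃ A ∈ 𝒜, f^[k] '' E ⊆ A), (n : ℕ∞)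

/-- Bowen's size `D_𝒜(E) = exp(-n(E))`, where `n(E)` is `bowenTime f 𝒜 E` and `exp(-∞) = 0`. -/
def bowenSize {X : Type*} (f : X → X) (𝒜 : Set (Set X)) (E : Set X) : ℝ≥0∞ :=
  EReal.exp (-((bowenTime f 𝒜 E : ℝ≥0∞) : EReal))

/-- Bowen's outer measure `m_{𝒜,s}(Y) = lim_{ε → 0} inf ∑ D_𝒜(E_i)^s`, the infimum being over the
countable covers `(E_i)` of `Y` with `D_𝒜(E_i) < ε` for all `i`. The infimum increases as `ε`
decreases, so the limit is a supremum. (Finite covers are padded with empty sets, of size `0`.) -/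
def bowenMeasure {X : Type*} (f : X → X) (𝒜 : Set (Set X)) (s : ℝ) (Y : Set X) : ℝ≥0∞ :=
  ⨆ (ε : ℝ≥0∞) (_ : 0 < ε),
    ⨅ (E : ℕ → Set X) (_ : Y ⊆ ⋃ i, E i) (_ : ∀ i, bowenSize f 𝒜 (E i) < ε),
      ∑' i, bowenSize f 𝒜 (E i) ^ s

/-- The entropy of `Y` relative to the cover `𝒜`: `inf {s > 0 : m_{𝒜,s}(Y) = 0}`. -/
def bowenEntropyCover {X : Type*} (f : X → X) (𝒜 : Set (Set X)) (Y : Set X) : ℝ≥0∞ :=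
  ⨅ (s : ℝ≥0) (_ : 0 < s) (_ : bowenMeasure f 𝒜 (s : ℝ) Y = 0), (s : ℝ≥0∞)

/-- Bowen's topological entropy `h_top(f, Y)` of an arbitrary subset `Y`: the supremum of the
entropies of `Y` relative to the finite open covers of the whole space. -/
def bowenEntropy {X : Type*} [TopologicalSpace X] (f : X → X) (Y : Set X) : ℝ≥0∞ :=
  ⨆ (𝒜 : Set (Set X)) (_ : 𝒜.Finite) (_ : ∀ A ∈ 𝒜, IsOpen A) (_ : ⋃₀ 𝒜 = univ),
    bowenEntropyCover f 𝒜 Y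

/-- The topological entropy `h_top(f) = h_top(f, X)` of the system. -/
def topEntropy {X : Type*} [TopologicalSpace X] (f : X → X) : ℝ≥0∞ :=
  bowenEntropy f univ

/-! ### Metric (Kolmogorov–Sinai) entropy -/

/-- Shannon entropy `-∑ μ(P) log μ(P)` of the finite partition into the fibres of `ξ`. -/
def partitionEntropy {X ι : Type*} [MeasurableSpace X] [Fintype ι]
    (μ : Measure X) (ξ : X → ι) : ℝ :=
  ∑ i, Real.negMulLog (μ.real (ξ ⁻¹' {i}))

/-- The labelling map of the join `ξ ∨ f⁻¹ξ ∨ ⋯ ∨ f^{-(n-1)}ξ`. -/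
def itinerary {X ι : Type*} (f : X → X) (ξ : X → ι) (n : ℕ) : X → (Fin n → ι) :=
  fun x j => ξ (f^[(j : ℕ)] x)

/-- The entropy `h_μ(f, ξ) = lim (1/n) H_μ(ξ ∨ ⋯ ∨ f^{-(n-1)}ξ)`. The limit exists for invariant
`μ`, so that it is the upper limit. -/
def ksEntropyPartition {X : Type*} [MeasurableSpace X] (f : X → X) (μ : Measure X)
    {k : ℕ} (ξ : X → Fin k) : ℝ≥0∞ :=
  limsup (fun n : ℕ => ENNReal.ofReal (partitionEntropy μ (itinerary f ξ n) / n)) atTop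

/-- The metric entropy `h_μ(f)`: the supremum of `h_μ(f, ξ)` over the finite measurable
partitions `ξ`, given by their measurable labelling maps. -/
def ksEntropy {X : Type*} [MeasurableSpace X] (f : X → X) (μ : Measure X) : ℝ≥0∞ :=
  ⨆ (k : ℕ) (ξ : X → Fin k) (_ : Measurable ξ), ksEntropyPartition f μ ξ

/-! ### Invariant measures, generic points, Birkhoff level sets -/

/-- The set of `f`-invariant Borel probability measures, inside the space `ProbabilityMeasure X`
with its topology of weak convergence. -/
def invariantMeasures {X : Type*} [MeasurableSpace X] (f : X → X) : Set (ProbabilityMeasure X) :=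
  {μ | MeasurePreserving f (μ : Measure X) (μ : Measure X)}

/-- The empirical measure `(1/(n+1)) ∑_{k=0}^{n} δ_{f^k x}` of the first `n + 1` points of the
orbit of `x` (so that it is a probability measure for every `n`). -/
def empiricalMeasure {X : Type*} [MeasurableSpace X] (f : X → X) (x : X) (n : ℕ) :
    ProbabilityMeasure X :=
  ⟨((n + 1 : ℕ) : ℝ≥0∞)⁻¹ • ∑ k ∈ Finset.range (n + 1), Measure.dirac (f^[k] x), by
    refine ⟨?_⟩
    simp only [Measure.smul_apply, Measure.finsetSum_apply, measure_univ, smul_eq_mul,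
      Finset.sum_const, Finset.card_range, nsmul_eq_mul, mul_one]
    exact ENNReal.inv_mul_cancel (by simp) (ENNReal.natCast_ne_top _)⟩

/-- The set `G_μ` of the points whose empirical measures converge weakly to `μ`. -/
def genericSet {X : Type*} [TopologicalSpace X] [MeasurableSpace X] [OpensMeasurableSpace X]
    (f : X → X) (μ : ProbabilityMeasure X) : Set X :=
  {x | Tendsto (empiricalMeasure f x) atTop (𝓝 μ)}

/-- The saturated property for every invariant measure: `G_μ ≠ ∅` and `h_top(f, G_μ) = h_μ(f)`
for every invariant probability measure `μ`. -/
def SaturatedProperty {X : Type*} [TopologicalSpace X] [MeasurableSpace X]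
    [OpensMeasurableSpace X] (f : X → X) : Prop :=
  ∀ μ ∈ invariantMeasures f,
    (genericSet f μ).Nonempty ∧ bowenEntropy f (genericSet f μ) = ksEntropy f (μ : Measure X)

/-- `m` is a measure of maximal entropy: it is invariant and `h_m(f) = h_top(f)`. -/
def IsMaxEntropyMeasure {X : Type*} [TopologicalSpace X] [MeasurableSpace X]
    (f : X → X) (m : ProbabilityMeasure X) : Prop :=
  m ∈ invariantMeasures f ∧ ksEntropy f (m : Measure X) = topEntropy f

/-- The Birkhoff level set `L(φ, α)`. -/
def levelSet {X : Type*} (f : X → X) (φ : X → ℝ) (α : ℝ) : Set X :=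
  {x | Tendsto (fun n : ℕ => birkhoffAverage ℝ f φ n x) atTop (𝓝 α)}

/-- The rotation set `R(φ)`: the values `α` whose level set is nonempty. -/
def rotationSet {X : Type*} (f : X → X) (φ : X → ℝ) : Set ℝ :=
  {α | (levelSet f φ α).Nonempty}

/-- The multifractal entropy spectrum `α ↦ h_top(f, L(φ, α))`. -/
def entropySpectrum {X : Type*} [TopologicalSpace X] (f : X → X) (φ : X → ℝ) (α : ℝ) : ℝ≥0∞ :=
  bowenEntropy f (levelSet f φ α)

end

/-!
The spectrum `α ↦ h_top(f, L(φ, α))` is the maximum of `h_μ(f)` over the invariant measures `μ` with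
`∫ φ dμ = α`; all the assertions are read off from this conditional variational principle
(`ksEntropy_le_entropySpectrum` and `exists_ksEntropy_eq_entropySpectrum`).

The lower bound is the saturated property, as `G_μ ⊆ L(φ, α)`. The upper bound is due to Bowen
(`bowenEntropy_le_of_isCompact`): if the empirical measures of all points of `Y` accumulate only at
a compact set `K` of invariant measures of entropy at most `t`, then `h_top(f, Y) ≤ t`. For its
proof, take `μ ∈ K` and a finite partition subordinate to the given cover, with `μ`-null boundaries,
so that the frequencies of the words of length `n` are continuous at `μ`. Choose a large
`n` with `H_μ(n-words)` at most about `n t`, and a positive probability vector `q ≥ μ / 2` on these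
words, which costs a negligible summand `log 2`. For `x` with empirical measure near `μ`, the average of `-log q` along the orbit
is at most about `n t`, hence so is the average along one of the residue classes modulo `n`. As the
products of the weights `q` over all sequences of blocks sum to `1`, at most `exp (N t)` sequences
can occur up to time `N`, up to the errors (`hasOrbitGrowth_of_weight`). Compactness of `K` makes
this uniform, and summing over `N` gives covers of `Y` as in Bowen's definition
(`HasOrbitGrowth.bowenMeasure_eq_zero`).

Bowen's bound uses `(1/n) H_μ` only along a subsequence, so it holds with lower limits in the
definition of the metric entropy. Applied to `K = {μ}` and `Y = G_μ`, it shows together with the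
saturated property that lower and upper limits give the same entropy, with no appeal to
subadditivity. Concavity of the metric entropy is then immediate from that of `-x log x`.

Finally, `R(φ)` is the image of the nonempty compact convex set of invariant measures under
integration of `φ`. Concavity of the spectrum is that of the entropy; upper semicontinuity is
inherited from the entropy map by compactness, and lower semicontinuity follows from concavity on an
interval. If the spectrum takes the value `h_top(f)` at `α`, then a maximizing measure is a measure
of maximal entropy with integral `α`.
-/

/-! ### Covers by sets with long Bowen times -/

lemma bowenSize_le_of_le_bowenTime {X : Type*} {f : X → X} {𝒜 : Set (Set X)} {E : Set X} {N : ℕ}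
    (h : ∀ k < N, ∃ A ∈ 𝒜, f^[k] '' E ⊆ A) :
    bowenSize f 𝒜 E ≤ ENNReal.ofReal (Real.exp (-N)) := by
  have h1 : (N : ℕ∞) ≤ bowenTime f 𝒜 E := le_iSup₂_of_le N h le_rfl
  have h2 : ((N : ℝ) : EReal) ≤ ((bowenTime f 𝒜 E : ℝ≥0∞) : EReal) := by
    have h3 : (N : ℝ≥0∞) ≤ (bowenTime f 𝒜 E : ℝ≥0∞) := by
      exact_mod_cast ENat.toENNReal_le.2 h1
    have h4 : ((N : ℝ≥0∞) : EReal) ≤ ((bowenTime f 𝒜 E : ℝ≥0∞) : EReal) :=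
      EReal.coe_ennreal_le_coe_ennreal_iff.2 h3
    have h5 : ((N : ℝ) : EReal) = ((N : ℝ≥0∞) : EReal) := by
      rw [← ENNReal.ofReal_natCast, EReal.coe_ennreal_ofReal, max_eq_left (Nat.cast_nonneg N)]
    rwa [h5]
  rw [bowenSize, ← EReal.exp_coe]
  refine EReal.exp_monotone ?_
  rw [EReal.coe_neg]
  exact EReal.neg_le_neg_iff.2 h2

lemma bowenSize_empty {X : Type*} [Nonempty X] (f : X → X) {𝒜 : Set (Set X)}
    (h𝒜 : ⋃₀ 𝒜 = univ) : bowenSize f 𝒜 ∅ = 0 := by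
  obtain ⟨A, hA, -⟩ : (Classical.arbitrary X) ∈ ⋃₀ 𝒜 := h𝒜 ▸ mem_univ _
  have h1 : bowenTime f 𝒜 ∅ = ⊤ := by
    refine ENat.eq_top_iff_forall_ge.2 fun n => ?_
    exact le_iSup₂_of_le n (fun k _ => ⟨A, hA, by simp⟩) le_rfl
  simp [bowenSize, h1]

/-- Any countable index set may be used for the covers in the definition of `bowenMeasure`. -/
lemma bowenMeasure_eq_zero_of_forall_cover.{u} {X : Type u} [Nonempty X] {f : X → X}
    {𝒜 : Set (Set X)} (h𝒜 : ⋃₀ 𝒜 = univ) {s : ℝ} (hs : 0 < s) {Y : Set X}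
    (h : ∀ ε : ℝ≥0∞, 0 < ε → ∃ (ι : Type u) (_ : Countable ι) (E : ι → Set X), Y ⊆ ⋃ i, E i ∧
      (∀ i, bowenSize f 𝒜 (E i) < ε) ∧ ∑' i, bowenSize f 𝒜 (E i) ^ s ≤ ε) :
    bowenMeasure f 𝒜 s Y = 0 := by
  rw [bowenMeasure]
  simp only [ENNReal.iSup_eq_zero]
  intro ε hε
  refine le_antisymm (ENNReal.le_of_forall_pos_le_add fun δ hδ _ => ?_) bot_le
  obtain ⟨ι, _, E, hY, hE, hsum⟩ := h (min ε δ) (lt_min hε (by exact_mod_cast hδ))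
  obtain ⟨g, hg⟩ := exists_injective_nat ι
  have hext : ∀ i, Function.extend g E (fun _ => ∅) (g i) = E i := fun i =>
    hg.extend_apply E _ i
  have hext' : ∀ n, n ∉ range g → Function.extend g E (fun _ => ∅) n = ∅ := fun n hn =>
    Function.extend_apply' E _ n hn
  refine iInf₂_le_of_le (Function.extend g E fun _ => ∅) (fun x hx => ?_)
    (iInf_le_of_le (fun n => ?_) ?_)
  · obtain ⟨i, hi⟩ := mem_iUnion.1 (hY hx)
    exact mem_iUnion.2 ⟨g i, by rwa [hext]⟩
  · by_cases hn : n ∈ range g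
    · obtain ⟨i, rfl⟩ := hn
      rw [hext]
      exact (hE i).trans_le (min_le_left _ _)
    · rw [hext' n hn, bowenSize_empty f h𝒜]
      exact hε
  · rw [← hg.tsum_eq]
    · simp only [hext]
      rw [zero_add]
      exact hsum.trans (min_le_right _ _)
    · intro n hn
      by_contra hn'
      exact hn (by simp [hext' n hn', bowenSize_empty f h𝒜, hs])

/-- Exponential growth at rate `s` of the number of orbit types seen by the points whose empirical
measure lies in `U`: for every `N`, at most `C * exp (s * N)` sets, whose first `N` iterates are
subordinate to `𝒜`, cover the points `x` with `empiricalMeasure f x N ∈ U`. -/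
def HasOrbitGrowth {X : Type*} [MeasurableSpace X] (f : X → X) (𝒜 : Set (Set X)) (s : ℝ)
    (U : Set (ProbabilityMeasure X)) : Prop :=
  ∃ C : ℝ, 0 ≤ C ∧ ∀ N : ℕ, ∃ F : Finset (Set X), (F.card : ℝ) ≤ C * Real.exp (s * N) ∧
    (∀ E ∈ F, ∀ k < N, ∃ A ∈ 𝒜, f^[k] '' E ⊆ A) ∧
    {x | empiricalMeasure f x N ∈ U} ⊆ ⋃₀ (F : Set (Set X))

lemma HasOrbitGrowth.empty {X : Type*} [MeasurableSpace X] (f : X → X) (𝒜 : Set (Set X)) (s : ℝ) :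
    HasOrbitGrowth f 𝒜 s ∅ :=
  ⟨0, le_rfl, fun _ => ⟨∅, by simp, by simp, by simp⟩⟩

lemma HasOrbitGrowth.union {X : Type*} [MeasurableSpace X] {f : X → X} {𝒜 : Set (Set X)} {s : ℝ}
    {U V : Set (ProbabilityMeasure X)} (hU : HasOrbitGrowth f 𝒜 s U)
    (hV : HasOrbitGrowth f 𝒜 s V) : HasOrbitGrowth f 𝒜 s (U ∪ V) := by
  classical
  obtain ⟨C, hC0, hC⟩ := hU
  obtain ⟨D, hD0, hD⟩ := hV
  refine ⟨C + D, add_nonneg hC0 hD0, fun N => ?_⟩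
  obtain ⟨F, hF1, hF2, hF3⟩ := hC N
  obtain ⟨G, hG1, hG2, hG3⟩ := hD N
  refine ⟨F ∪ G, ?_, fun E hE => (Finset.mem_union.1 hE).elim (hF2 E) (hG2 E), ?_⟩
  · have h1 : ((F ∪ G).card : ℝ) ≤ F.card + G.card := by
      exact_mod_cast Finset.card_union_le F G
    linarith [add_mul C D (Real.exp (s * N))]
  · rintro x (hx | hx)
    · rw [Finset.coe_union, sUnion_union]
      exact Or.inl (hF3 hx)
    · rw [Finset.coe_union, sUnion_union]
      exact Or.inr (hG3 hx)

/-- If the empirical measures of the points of `Y` are eventually in a set where the orbit types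
grow at rate `s`, then the orbit types of all lengths `N ≥ N₀` cover `Y`, and the sums of the
`s'`-th powers of their sizes are tails of a geometric series. -/
lemma HasOrbitGrowth.bowenMeasure_eq_zero {X : Type*} [Nonempty X] [MeasurableSpace X] {f : X → X}
    {𝒜 : Set (Set X)} (h𝒜 : ⋃₀ 𝒜 = univ) {s s' : ℝ} (hs' : 0 < s') (hss' : s < s')
    {U : Set (ProbabilityMeasure X)} (hU : HasOrbitGrowth f 𝒜 s U) {Y : Set X}
    (hY : ∀ x ∈ Y, ∀ᶠ N in atTop, empiricalMeasure f x N ∈ U) :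
    bowenMeasure f 𝒜 s' Y = 0 := by
  obtain ⟨C, hC0, hC⟩ := hU
  choose F hF1 hF2 hF3 using hC
  have hsize : ∀ N, ∀ E ∈ F N, bowenSize f 𝒜 E ≤ ENNReal.ofReal (Real.exp (-N)) := fun N E hE =>
    bowenSize_le_of_le_bowenTime (hF2 N E hE)
  set u : ℕ → ℝ≥0∞ := fun N => ∑ E ∈ F N, bowenSize f 𝒜 E ^ s' with hu
  have hule : ∀ N, u N ≤ ENNReal.ofReal (C * Real.exp (s - s') ^ N) := by
    intro N
    calc u N ≤ ∑ E ∈ F N, ENNReal.ofReal (Real.exp (-N)) ^ s' :=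
          Finset.sum_le_sum fun E hE => ENNReal.rpow_le_rpow (hsize N E hE) hs'.le
      _ = ENNReal.ofReal ((F N).card * Real.exp (-N * s')) := by
          rw [Finset.sum_const, nsmul_eq_mul, ENNReal.ofReal_rpow_of_pos (Real.exp_pos _),
            ← Real.exp_mul, ENNReal.ofReal_mul (by positivity), ENNReal.ofReal_natCast]
      _ ≤ ENNReal.ofReal (C * Real.exp (s * N) * Real.exp (-N * s')) := by
          gcongr
          exact hF1 N
      _ = ENNReal.ofReal (C * Real.exp (s - s') ^ N) := by
          rw [mul_assoc, ← Real.exp_add, ← Real.exp_nat_mul]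
          ring_nf
  have husum : ∑' N, u N ≠ ∞ := by
    refine ne_top_of_le_ne_top ?_ (ENNReal.tsum_le_tsum hule)
    refine Summable.tsum_ofReal_ne_top ?_
    exact (summable_geometric_of_lt_one (Real.exp_pos _).le
      (Real.exp_lt_one_iff.2 (by linarith))).mul_left C
  refine bowenMeasure_eq_zero_of_forall_cover h𝒜 hs' fun ε hε => ?_
  have hlim : Tendsto (fun N : ℕ => ENNReal.ofReal (Real.exp (-N))) atTop (𝓝 0) := by
    rw [← ENNReal.ofReal_zero]
    exact ENNReal.tendsto_ofReal
      (Real.tendsto_exp_neg_atTop_nhds_zero.comp tendsto_natCast_atTop_atTop)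
  obtain ⟨N₀, hN₁, hN₂⟩ := ((hlim.eventually_lt_const hε).and
    ((ENNReal.tendsto_sum_nat_add u husum).eventually_lt_const hε)).exists
  refine ⟨Σ N : ℕ, {E // E ∈ F (N + N₀)}, inferInstance, fun i => i.2.1, ?_, ?_, ?_⟩
  · intro x hx
    obtain ⟨N, hN, hxN⟩ := ((eventually_ge_atTop N₀).and (hY x hx)).exists
    obtain ⟨E, hE, hxE⟩ := hF3 N hxN
    exact mem_iUnion.2 ⟨⟨N - N₀, E, by rwa [Nat.sub_add_cancel hN]⟩, hxE⟩
  · rintro ⟨N, E, hE⟩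
    refine ((hsize _ E hE).trans (ENNReal.ofReal_le_ofReal (Real.exp_le_exp.2 ?_))).trans_lt hN₁
    push_cast
    linarith [(Nat.cast_nonneg N : (0 : ℝ) ≤ N)]
  · rw [ENNReal.tsum_sigma']
    refine le_trans (le_of_eq (tsum_congr fun N => ?_)) hN₂.le
    rw [tsum_fintype, hu]
    exact Finset.sum_coe_sort (F (N + N₀)) fun E => bowenSize f 𝒜 E ^ s'

/-! ### Counting orbit types by weights -/

/-- If `q` is a probability vector, then at most `exp R` words `b` have `-log ∏ q (b i) ≤ R`,
because the products `∏ q (b i)` sum to `1`. -/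
lemma card_filter_sum_neg_log_le {A ι : Type*} [Fintype A] [Fintype ι] [DecidableEq ι]
    {q : A → ℝ} (hq : ∀ a, 0 < q a) (hq1 : ∑ a, q a = 1) (R : ℝ) :
    ((Finset.univ.filter fun b : ι → A => ∑ i, -Real.log (q (b i)) ≤ R).card : ℝ)
      ≤ Real.exp R := by
  set S := Finset.univ.filter fun b : ι → A => ∑ i, -Real.log (q (b i)) ≤ R
  have h1 : ∑ b : ι → A, ∏ i, q (b i) = 1 := by
    rw [← Fintype.piFinset_univ, ← Finset.prod_univ_sum]
    simp [hq1]
  have h2 : ∀ b ∈ S, Real.exp (-R) ≤ ∏ i, q (b i) := by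
    intro b hb
    have hb' : ∑ i, -Real.log (q (b i)) ≤ R := (Finset.mem_filter.1 hb).2
    rw [Finset.sum_neg_distrib] at hb'
    calc Real.exp (-R) ≤ Real.exp (∑ i, Real.log (q (b i))) := Real.exp_le_exp.2 (by linarith)
      _ = ∏ i, q (b i) := by
        rw [Real.exp_sum]
        exact Finset.prod_congr rfl fun i _ => Real.exp_log (hq _)
  have h3 : (S.card : ℝ) * Real.exp (-R) ≤ 1 := by
    calc (S.card : ℝ) * Real.exp (-R) = ∑ _b ∈ S, Real.exp (-R) := by simp
      _ ≤ ∑ b ∈ S, ∏ i, q (b i) := Finset.sum_le_sum h2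
      _ ≤ ∑ b : ι → A, ∏ i, q (b i) :=
        Finset.sum_le_univ_sum_of_nonneg fun b => Finset.prod_nonneg fun i _ => (hq _).le
      _ = 1 := h1
  rwa [Real.exp_neg, ← div_eq_mul_inv, div_le_one (Real.exp_pos R)] at h3

/-- One of the `n` residue classes modulo `n` carries at most a fraction `1/n` of the sum. -/
lemma exists_residue_sum_le {a : ℕ → ℝ} (ha : ∀ i, 0 ≤ a i) {n N : ℕ} (hn : 0 < n) {R : ℝ}
    (h : ∑ i ∈ Finset.range (N + 1), a i ≤ n * R) :
    ∃ j : Fin n, ∑ i : Fin (N / n), a (j + n * i) ≤ R := by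
  have h1 : ∑ j : Fin n, ∑ i : Fin (N / n), a (j + n * i) ≤ ∑ _j : Fin n, R := by
    rw [Finset.sum_comm, ← Fintype.sum_prod_type' fun (i : Fin (N / n)) (j : Fin n) =>
      a (j + n * i)]
    calc ∑ x : Fin (N / n) × Fin n, a (x.2 + n * x.1)
        = ∑ i : Fin (N / n * n), a i :=
          Fintype.sum_equiv finProdFinEquiv _ _ fun x => by simp
      _ = ∑ i ∈ Finset.range (N / n * n), a i := Fin.sum_univ_eq_sum_range a _
      _ ≤ ∑ i ∈ Finset.range (N + 1), a i :=
          Finset.sum_le_sum_of_subset_of_nonneg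
            (Finset.range_mono ((Nat.div_mul_le_self N n).trans N.le_succ)) fun i _ _ => ha i
      _ ≤ ∑ _j : Fin n, R := by simpa using h
  have : Nonempty (Fin n) := ⟨⟨0, hn⟩⟩
  obtain ⟨j, -, hj⟩ := Finset.exists_le_of_sum_le Finset.univ_nonempty h1
  exact ⟨j, hj⟩

lemma integral_empiricalMeasure {X : Type*} [MeasurableSpace X] [MeasurableSingletonClass X]
    (f : X → X) (x : X) (N : ℕ) (g : X → ℝ) :
    ∫ y, g y ∂(empiricalMeasure f x N : Measure X)
      = (∑ k ∈ Finset.range (N + 1), g (f^[k] x)) / (N + 1) := by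
  have h : (empiricalMeasure f x N : Measure X)
      = ((N + 1 : ℕ) : ℝ≥0∞)⁻¹ • ∑ k ∈ Finset.range (N + 1), Measure.dirac (f^[k] x) := by
    simp [empiricalMeasure]
  rw [h, integral_smul_measure, integral_finsetSum_measure]
  · have h1 : ((N : ℝ≥0∞) + 1).toReal = N + 1 := by
      rw [ENNReal.toReal_add (ENNReal.natCast_ne_top N) ENNReal.one_ne_top]
      simp
    simp [integral_dirac, div_eq_inv_mul, h1]
  · exact fun i _ => integrable_dirac (by simp)

lemma measurable_itinerary {X ι : Type*} [MeasurableSpace X] [MeasurableSpace ι] {f : X → X}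
    (hf : Measurable f) {ξ : X → ι} (hξ : Measurable ξ) (n : ℕ) : Measurable (itinerary f ξ n) :=
  measurable_pi_lambda _ fun j => hξ.comp (hf.iterate j)

/-- The average of `c` over the itineraries of length `n` along an orbit. -/
lemma sum_empiricalMeasure_itinerary {X ι : Type*} [MeasurableSpace X] [MeasurableSingletonClass X]
    [Fintype ι] [MeasurableSpace ι] [MeasurableSingletonClass ι]
    {f : X → X} {ζ : X → ι} (hζ : Measurable ζ) (c : ι → ℝ) (x : X) (N : ℕ) :
    ∑ a, (empiricalMeasure f x N : Measure X).real (ζ ⁻¹' {a}) * c a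
      = (∑ k ∈ Finset.range (N + 1), c (ζ (f^[k] x))) / (N + 1) := by
  classical
  have h : ∀ a, (empiricalMeasure f x N : Measure X).real (ζ ⁻¹' {a})
      = (∑ k ∈ Finset.range (N + 1), if ζ (f^[k] x) = a then 1 else 0) / (N + 1) := by
    intro a
    rw [← integral_indicator_one (hζ (measurableSet_singleton a)), integral_empiricalMeasure]
    simp [indicator_apply]
  simp_rw [h, div_mul_eq_mul_div, ← Finset.sum_div, Finset.sum_mul]
  rw [Finset.sum_comm]
  simp

/-- The points whose average of `-log q` over the length-`n` itineraries is below `n * s` have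
at most `exp (s * N)` orbit types, up to a constant: along one residue class modulo `n` the
consecutive blocks have `-log` weight at most `s * (N + 1)`, and the orbit up to time `N` is
described by these blocks and the blocks at the two ends. -/
lemma hasOrbitGrowth_of_weight {X : Type*} [MeasurableSpace X] [MeasurableSingletonClass X]
    {f : X → X} (hf : Measurable f) {𝒜 : Set (Set X)} {κ : ℕ} {ξ : X → Fin κ}
    (hξ : Measurable ξ) (hξ𝒜 : ∀ i, ∃ A ∈ 𝒜, ξ ⁻¹' {i} ⊆ A) {n : ℕ} (hn : 0 < n) {s : ℝ}
    {q : (Fin n → Fin κ) → ℝ} (hq : ∀ a, 0 < q a) (hq1 : ∑ a, q a = 1) :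
    HasOrbitGrowth f 𝒜 s {ν | ∑ a, (ν : Measure X).real (itinerary f ξ n ⁻¹' {a})
      * -Real.log (q a) < n * s} := by
  classical
  have hc : ∀ a, 0 ≤ -Real.log (q a) := fun a => by
    have h1 : q a ≤ 1 :=
      hq1 ▸ Finset.single_le_sum (fun a _ => (hq a).le) (Finset.mem_univ a)
    linarith [Real.log_nonpos (hq a).le h1]
  -- `n` residues, `M` choices for each end block, and `exp (s * (N + 1))` sequences of blocks
  obtain ⟨M, hM⟩ : ∃ M : ℕ, M = Fintype.card (Fin n → Fin κ) := ⟨_, rfl⟩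
  refine ⟨n * (M * (M * Real.exp s)), by positivity, fun N => ?_⟩
  set S := Finset.univ.filter fun b : Fin (N / n) → Fin n → Fin κ =>
    ∑ i, -Real.log (q (b i)) ≤ (N + 1) * s with hS
  -- the orbit types: a residue `j`, the initial block `u`, the final block `v`, and the
  -- blocks `b i` at the times `j + n * i`
  let T : Fin n × (Fin n → Fin κ) × (Fin n → Fin κ) × (Fin (N / n) → Fin n → Fin κ) → Set X :=
    fun p => {x | itinerary f ξ n x = p.2.1 ∧ itinerary f ξ n (f^[n * (N / n)] x) = p.2.2.1 ∧
      ∀ i : Fin (N / n), itinerary f ξ n (f^[(p.1 : ℕ) + n * i] x) = p.2.2.2 i}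
  refine ⟨((Finset.univ ×ˢ Finset.univ ×ˢ Finset.univ ×ˢ S)).image T, ?_, ?_, ?_⟩
  · refine (Nat.cast_le.2 Finset.card_image_le).trans ?_
    have h1 : (S.card : ℝ) ≤ Real.exp s * Real.exp (s * N) := by
      refine (card_filter_sum_neg_log_le hq hq1 _).trans_eq ?_
      rw [← Real.exp_add]
      ring_nf
    rw [Finset.card_product, Finset.card_product, Finset.card_product, Finset.card_univ,
      Finset.card_univ, ← hM, Fintype.card_fin]
    push_cast
    calc (n : ℝ) * (M * (M * S.card)) ≤ n * (M * (M * (Real.exp s * Real.exp (s * N)))) := by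
          gcongr
      _ = _ := by ring
  · intro E hE k hk
    obtain ⟨⟨j, u, v, b⟩, -, rfl⟩ := Finset.mem_image.1 hE
    -- at the time `k`, one of the recorded blocks determines the symbol
    obtain ⟨i, hi⟩ : ∃ i, ∀ x ∈ T (j, u, v, b), ξ (f^[k] x) = i := by
      rcases lt_or_ge k n with hkn | hkn
      · refine ⟨u ⟨k, hkn⟩, fun x hx => ?_⟩
        exact congrFun hx.1 ⟨k, hkn⟩
      rcases lt_or_ge k (n * (N / n)) with hkm | hkm
      · have hjk : (j : ℕ) ≤ k := j.2.le.trans hkn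
        have hi : (k - j) / n < N / n := by
          rw [Nat.div_lt_iff_lt_mul hn, mul_comm]
          omega
        refine ⟨b ⟨(k - j) / n, hi⟩ ⟨(k - j) % n, Nat.mod_lt _ hn⟩, fun x hx => ?_⟩
        have h1 := congrFun (hx.2.2 ⟨(k - j) / n, hi⟩) ⟨(k - j) % n, Nat.mod_lt _ hn⟩
        simp only [itinerary, ← Function.iterate_add_apply] at h1
        rw [← h1]
        congr 2
        have := Nat.mod_add_div (k - j) n
        omega
      · have hkv : k - n * (N / n) < n := by
          have := Nat.mod_add_div N n
          have := Nat.mod_lt N hn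
          omega
        refine ⟨v ⟨k - n * (N / n), hkv⟩, fun x hx => ?_⟩
        have h1 := congrFun hx.2.1 ⟨k - n * (N / n), hkv⟩
        simp only [itinerary, ← Function.iterate_add_apply] at h1
        rw [← h1, Nat.sub_add_cancel hkm]
    obtain ⟨A, hA, hiA⟩ := hξ𝒜 i
    refine ⟨A, hA, ?_⟩
    rintro _ ⟨x, hx, rfl⟩
    exact hiA (hi x hx)
  · intro x hx
    have hx' : ∑ k ∈ Finset.range (N + 1), -Real.log (q (itinerary f ξ n (f^[k] x)))
        ≤ n * ((N + 1) * s) := by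
      have h1 : ∑ a, (empiricalMeasure f x N : Measure X).real (itinerary f ξ n ⁻¹' {a})
          * -Real.log (q a) < n * s := hx
      rw [sum_empiricalMeasure_itinerary (measurable_itinerary hf hξ n) (fun a => -Real.log (q a)),
        div_lt_iff₀ (by positivity)] at h1
      linarith
    obtain ⟨j, hj⟩ := exists_residue_sum_le (fun k => hc _) hn hx'
    refine ⟨T (j, itinerary f ξ n x, itinerary f ξ n (f^[n * (N / n)] x),
      fun i => itinerary f ξ n (f^[(j : ℕ) + n * i] x)), ?_, rfl, rfl, fun i => rfl⟩
    rw [Finset.mem_coe]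
    refine Finset.mem_image_of_mem _ ?_
    simp only [Finset.mem_product, Finset.mem_univ, true_and, hS, Finset.mem_filter]
    exact hj

/-! ### Partitions with null boundaries -/

lemma frontier_iInter_subset_iUnion {X ι : Type*} [TopologicalSpace X] [Finite ι] (s : ι → Set X) :
    frontier (⋂ i, s i) ⊆ ⋃ i, frontier (s i) := by
  rintro x ⟨hx1, hx2⟩
  rw [interior_iInter_of_finite, mem_iInter, not_forall] at hx2
  obtain ⟨i, hi⟩ := hx2
  exact mem_iUnion.2 ⟨i, closure_mono (iInter_subset s i) hx1, hi⟩

/-- The partition is generated by finitely many balls whose boundaries are null sets. -/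
lemma exists_partition_null_frontier {X : Type*} [MetricSpace X] [CompactSpace X]
    [MeasurableSpace X] [BorelSpace X] (μ : Measure X) [IsFiniteMeasure μ] {𝒜 : Set (Set X)}
    (ho : ∀ A ∈ 𝒜, IsOpen A) (hc : ⋃₀ 𝒜 = univ) :
    ∃ (κ : ℕ) (ξ : X → Fin κ), Measurable ξ ∧
      ∀ i, μ (frontier (ξ ⁻¹' {i})) = 0 ∧ ((ξ ⁻¹' {i}).Nonempty → ∃ A ∈ 𝒜, ξ ⁻¹' {i} ⊆ A) := by
  classical
  have h1 : ∀ x : X, ∃ r > 0, μ (frontier (Metric.ball x r)) = 0 ∧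
      ∃ A ∈ 𝒜, Metric.ball x r ⊆ A := by
    intro x
    obtain ⟨A, hA, hxA⟩ : x ∈ ⋃₀ 𝒜 := hc ▸ mem_univ x
    obtain ⟨ε, hε, hεA⟩ := Metric.isOpen_iff.1 (ho A hA) x hxA
    obtain ⟨r, ⟨hr0, hrε⟩, hr⟩ := exists_null_frontier_thickening μ {x} hε
    rw [Metric.thickening_singleton] at hr
    exact ⟨r, hr0, hr, A, hA, (Metric.ball_subset_ball hrε.le).trans hεA⟩
  choose r hr0 hr hrA using h1
  obtain ⟨t, -, ht⟩ := isCompact_univ.elim_nhds_subcover (fun x : X => Metric.ball x (r x))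
    fun x _ => Metric.ball_mem_nhds x (hr0 x)
  -- each point is labelled by the set of the balls that contain it
  let e := Fintype.equivFin (t → Prop)
  let ξ : X → Fin (Fintype.card (t → Prop)) := fun y => e fun x => y ∈ Metric.ball (x : X) (r x)
  have hfib : ∀ i, ξ ⁻¹' {i} = ⋂ x : t,
      if e.symm i x then Metric.ball (x : X) (r x) else (Metric.ball (x : X) (r x))ᶜ := by
    intro i
    ext y
    rw [mem_iInter, mem_preimage, mem_singleton_iff, ← e.eq_symm_apply, funext_iff]
    refine forall_congr' fun x => ?_
    by_cases h : e.symm i x <;> simp [h]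
  refine ⟨_, ξ, measurable_to_countable' fun i => ?_, fun i => ⟨?_, ?_⟩⟩
  · rw [hfib]
    refine MeasurableSet.iInter fun x => ?_
    split_ifs
    · exact measurableSet_ball
    · exact measurableSet_ball.compl
  · rw [hfib]
    refine measure_mono_null (frontier_iInter_subset_iUnion _) (measure_iUnion_null fun x => ?_)
    split_ifs
    · exact hr x
    · rw [frontier_compl]
      exact hr x
  · rintro ⟨y, hy⟩
    obtain ⟨x, hx, hyx⟩ := mem_iUnion₂.1 (ht (mem_univ y))
    obtain ⟨A, hA, hxA⟩ := hrA x
    refine ⟨A, hA, fun z hz => hxA ?_⟩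
    have h2 : ξ z = ξ y := Eq.trans hz (Eq.symm hy)
    have h3 := congrFun (e.injective h2) ⟨x, hx⟩
    exact h3.symm ▸ hyx

lemma frontier_itinerary_null {X ι : Type*} [TopologicalSpace X] [MeasurableSpace X]
    {f : X → X} (hf : Continuous f) {μ : Measure X} (hμ : MeasurePreserving f μ μ)
    {ξ : X → ι} (hξ : ∀ i, μ (frontier (ξ ⁻¹' {i})) = 0) (n : ℕ) (a : Fin n → ι) :
    μ (frontier (itinerary f ξ n ⁻¹' {a})) = 0 := by
  have h1 : itinerary f ξ n ⁻¹' {a} = ⋂ j : Fin n, f^[(j : ℕ)] ⁻¹' (ξ ⁻¹' {a j}) := by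
    ext x
    simp [itinerary, funext_iff]
  rw [h1]
  refine measure_mono_null (frontier_iInter_subset_iUnion _) (measure_iUnion_null fun j => ?_)
  exact measure_mono_null ((hf.iterate j).frontier_preimage_subset _)
    ((hμ.iterate j).quasiMeasurePreserving.preimage_null (hξ (a j)))

/-- Weights `q = (μ + uniform) / 2` compare with `μ` at the cost of a summand `log 2`, and have no
zeros. -/
lemma exists_weight_sum_mul_neg_log_le {A : Type*} [Fintype A] [Nonempty A] {p : A → ℝ}
    (hp : ∀ a, 0 ≤ p a) (hp1 : ∑ a, p a = 1) :
    ∃ q : A → ℝ, (∀ a, 0 < q a) ∧ ∑ a, q a = 1 ∧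
      ∑ a, p a * -Real.log (q a) ≤ ∑ a, Real.negMulLog (p a) + Real.log 2 := by
  have hA : (0 : ℝ) < Fintype.card A := by exact_mod_cast Fintype.card_pos
  have hq : ∀ a, 0 < (p a + (Fintype.card A : ℝ)⁻¹) / 2 := fun a => by
    have := hp a
    positivity
  refine ⟨fun a => (p a + (Fintype.card A : ℝ)⁻¹) / 2, hq, ?_, ?_⟩
  · rw [← Finset.sum_div, Finset.sum_add_distrib, hp1]
    simp [hA.ne']
  · have h1 : ∀ a, p a * -Real.log ((p a + (Fintype.card A : ℝ)⁻¹) / 2)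
        ≤ Real.negMulLog (p a) + p a * Real.log 2 := by
      intro a
      rcases (hp a).eq_or_lt with h0 | h0
      · simp [← h0]
      · have h2 : Real.log (p a / 2) ≤ Real.log ((p a + (Fintype.card A : ℝ)⁻¹) / 2) :=
          Real.log_le_log (by positivity) (by have := inv_pos.2 hA; linarith)
        rw [Real.log_div h0.ne' two_ne_zero] at h2
        rw [Real.negMulLog]
        nlinarith
    calc _ ≤ ∑ a, (Real.negMulLog (p a) + p a * Real.log 2) := Finset.sum_le_sum fun a _ => h1 a
      _ = _ := by rw [Finset.sum_add_distrib, ← Finset.sum_mul, hp1, one_mul]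

lemma sum_measureReal_fibre {X ι : Type*} [MeasurableSpace X] [Fintype ι] [MeasurableSpace ι]
    [MeasurableSingletonClass ι] (μ : Measure X) [IsFiniteMeasure μ] {ζ : X → ι}
    (hζ : Measurable ζ) (s : Finset ι) : ∑ i ∈ s, μ.real (ζ ⁻¹' {i}) = μ.real (ζ ⁻¹' s) :=
  sum_measureReal_preimage_singleton s fun i _ => hζ (measurableSet_singleton i)

/-- If the entropy of an invariant measure at some time `n` is less than `n * s`, with the margin
`log 2` for the passage to positive weights, then orbit types grow at rate `s` near this measure. -/
lemma exists_isOpen_hasOrbitGrowth {X : Type*} [MetricSpace X] [Nonempty X]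
    [MeasurableSpace X] [BorelSpace X] {f : X → X} (hf : Continuous f) {𝒜 : Set (Set X)} {κ : ℕ}
    {ξ : X → Fin κ} (hξ : Measurable ξ) (hξ𝒜 : ∀ i, ∃ A ∈ 𝒜, ξ ⁻¹' {i} ⊆ A)
    {μ : ProbabilityMeasure X} (hμ : μ ∈ invariantMeasures f)
    (hfr : ∀ i, (μ : Measure X) (frontier (ξ ⁻¹' {i})) = 0) {n : ℕ} (hn : 0 < n) {s : ℝ}
    (hs : partitionEntropy (μ : Measure X) (itinerary f ξ n) + Real.log 2 < n * s) :
    ∃ U, IsOpen U ∧ μ ∈ U ∧ HasOrbitGrowth f 𝒜 s U := by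
  have hne : Nonempty (Fin n → Fin κ) := ⟨itinerary f ξ n (Classical.arbitrary X)⟩
  have hm := measurable_itinerary hf.measurable hξ n
  obtain ⟨q, hq, hq1, hqs⟩ := exists_weight_sum_mul_neg_log_le
    (p := fun a => (μ : Measure X).real (itinerary f ξ n ⁻¹' {a})) (fun a => measureReal_nonneg)
    (by rw [sum_measureReal_fibre _ hm]; simp)
  have hlim : Tendsto (fun ν : ProbabilityMeasure X =>
      ∑ a, (ν : Measure X).real (itinerary f ξ n ⁻¹' {a}) * -Real.log (q a)) (𝓝 μ)
      (𝓝 (∑ a, (μ : Measure X).real (itinerary f ξ n ⁻¹' {a}) * -Real.log (q a))) := by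
    refine tendsto_finsetSum _ fun a _ => Tendsto.mul_const _ ?_
    exact (ENNReal.tendsto_toReal (measure_ne_top _ _)).comp
      (ProbabilityMeasure.tendsto_measure_of_null_frontier_of_tendsto' tendsto_id
        (frontier_itinerary_null hf hμ hfr n a))
  obtain ⟨U, hU, hUo, hμU⟩ := mem_nhds_iff.1 (hlim.eventually_lt_const (hqs.trans_lt hs))
  obtain ⟨C, hC0, hC⟩ := hasOrbitGrowth_of_weight hf.measurable hξ hξ𝒜 hn (s := s) hq hq1
  refine ⟨U, hUo, hμU, C, hC0, fun N => ?_⟩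
  obtain ⟨F, hF1, hF2, hF3⟩ := hC N
  exact ⟨F, hF1, hF2, fun x hx => hF3 (hU hx)⟩

/-! ### Upper bound for the entropy of a set by the entropies of limit measures -/

/-- The variant of `ksEntropy` with the lower limit instead of the upper limit. It is an upper bound
for the entropy of sets of points with prescribed limit measures, and lower limits are
superadditive, which makes concavity in the measure accessible; `ksEntropyLower_eq_ksEntropy` gives
equality under the saturated property. -/
noncomputable def ksEntropyLower {X : Type*} [MeasurableSpace X] (f : X → X) (μ : Measure X) :
    ℝ≥0∞ :=
  ⨆ (k : ℕ) (ξ : X → Fin k) (_ : Measurable ξ),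
    liminf (fun n : ℕ => ENNReal.ofReal (partitionEntropy μ (itinerary f ξ n) / n)) atTop

lemma liminf_le_ksEntropyLower {X : Type*} [MeasurableSpace X] (f : X → X) (μ : Measure X) {k : ℕ}
    {ξ : X → Fin k} (hξ : Measurable ξ) :
    liminf (fun n : ℕ => ENNReal.ofReal (partitionEntropy μ (itinerary f ξ n) / n)) atTop
      ≤ ksEntropyLower f μ :=
  le_iSup_of_le k (le_iSup_of_le ξ (le_iSup_of_le hξ le_rfl))

lemma ksEntropyLower_le_ksEntropy {X : Type*} [MeasurableSpace X] (f : X → X) (μ : Measure X) :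
    ksEntropyLower f μ ≤ ksEntropy f μ :=
  iSup_mono fun _ => iSup_mono fun _ => iSup_mono fun _ => liminf_le_limsup

lemma exists_isOpen_hasOrbitGrowth_of_ksEntropyLower_lt {X : Type*} [MetricSpace X]
    [CompactSpace X] [Nonempty X] [MeasurableSpace X] [BorelSpace X] {f : X → X}
    (hf : Continuous f) {𝒜 : Set (Set X)} (ho : ∀ A ∈ 𝒜, IsOpen A) (hc : ⋃₀ 𝒜 = univ)
    {μ : ProbabilityMeasure X} (hμ : μ ∈ invariantMeasures f) {s : ℝ≥0}
    (hs : ksEntropyLower f (μ : Measure X) < s) :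
    ∃ U, IsOpen U ∧ μ ∈ U ∧ HasOrbitGrowth f 𝒜 s U := by
  obtain ⟨κ, ξ, hξ, hξ'⟩ := exists_partition_null_frontier (μ : Measure X) ho hc
  have hξ𝒜 : ∀ i, ∃ A ∈ 𝒜, ξ ⁻¹' {i} ⊆ A := by
    intro i
    rcases (ξ ⁻¹' {i}).eq_empty_or_nonempty with h | h
    · obtain ⟨A, hA, -⟩ : (Classical.arbitrary X) ∈ ⋃₀ 𝒜 := hc ▸ mem_univ _
      exact ⟨A, hA, h ▸ empty_subset A⟩
    · exact (hξ' i).2 h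
  obtain ⟨r, hr, hrs⟩ := ENNReal.lt_iff_exists_nnreal_btwn.1 hs
  have hrs' : (0 : ℝ) < s - r := sub_pos.2 (by exact_mod_cast hrs)
  have h1 : liminf (fun n : ℕ => ENNReal.ofReal
      (partitionEntropy (μ : Measure X) (itinerary f ξ n) / n)) atTop < r :=
    (liminf_le_ksEntropyLower f _ hξ).trans_lt hr
  have h2 : ∀ᶠ n : ℕ in atTop, Real.log 2 < n * (s - r) :=
    (tendsto_natCast_atTop_atTop.atTop_mul_const hrs').eventually_gt_atTop _
  obtain ⟨n, hn1, hn2, hn⟩ := ((frequently_lt_of_liminf_lt (by isBoundedDefault) h1).and_eventually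
    (h2.and (eventually_gt_atTop 0))).exists
  refine exists_isOpen_hasOrbitGrowth hf hξ hξ𝒜 hμ (fun i => (hξ' i).1) hn ?_
  have hn0 : (0 : ℝ) < n := by exact_mod_cast hn
  have h3 : partitionEntropy (μ : Measure X) (itinerary f ξ n) / n < r := by
    by_contra! h
    exact hn1.not_ge (by simpa using ENNReal.ofReal_le_ofReal h)
  rw [div_lt_iff₀ hn0] at h3
  linarith

/-- Bowen's bound: if the empirical measures of every point of `Y` accumulate only at a compact set
`K` of invariant measures of entropy at most `t`, then `h_top(f, Y) ≤ t`. By compactness, orbit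
types grow at a rate close to `t` on a whole neighbourhood of `K`. -/
theorem bowenEntropy_le_of_isCompact {X : Type*} [MetricSpace X]
    [CompactSpace X] [Nonempty X] [MeasurableSpace X] [BorelSpace X] {f : X → X}
    (hf : Continuous f) {K : Set (ProbabilityMeasure X)} (hK : IsCompact K)
    (hKf : K ⊆ invariantMeasures f) {t : ℝ≥0∞}
    (ht : ∀ μ ∈ K, ksEntropyLower f (μ : Measure X) ≤ t) {Y : Set X}
    (hY : ∀ U, IsOpen U → K ⊆ U → ∀ x ∈ Y, ∀ᶠ N in atTop, empiricalMeasure f x N ∈ U) :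
    bowenEntropy f Y ≤ t := by
  refine iSup_le fun 𝒜 => iSup_le fun _ => iSup_le fun ho => iSup_le fun hc => ?_
  refine ENNReal.le_of_forall_pos_le_add fun ε hε htop => ?_
  lift t to ℝ≥0 using htop.ne
  have h1 : ∃ U, IsOpen U ∧ K ⊆ U ∧ HasOrbitGrowth f 𝒜 (t + ε / 2 : ℝ≥0) U := by
    refine hK.induction_on (p := fun S => ∃ U, IsOpen U ∧ S ⊆ U ∧
      HasOrbitGrowth f 𝒜 (t + ε / 2 : ℝ≥0) U) ?_ ?_ ?_ ?_
    · exact ⟨∅, isOpen_empty, Subset.rfl, HasOrbitGrowth.empty f 𝒜 _⟩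
    · rintro S S' hS ⟨U, hU, hSU, h⟩
      exact ⟨U, hU, hS.trans hSU, h⟩
    · rintro S S' ⟨U, hU, hSU, h⟩ ⟨U', hU', hSU', h'⟩
      exact ⟨U ∪ U', hU.union hU', union_subset_union hSU hSU', h.union h'⟩
    · intro μ hμ
      obtain ⟨U, hU, hμU, h⟩ := exists_isOpen_hasOrbitGrowth_of_ksEntropyLower_lt hf ho hc
        (hKf hμ) (s := t + ε / 2)
        ((ht μ hμ).trans_lt (ENNReal.coe_lt_coe.2 (lt_add_of_pos_right t (half_pos hε))))
      exact ⟨U, mem_nhdsWithin_of_mem_nhds (hU.mem_nhds hμU), U, hU, Subset.rfl, h⟩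
  obtain ⟨U, hU, hKU, h⟩ := h1
  have h2 : bowenMeasure f 𝒜 ((t + ε : ℝ≥0) : ℝ) Y = 0 := by
    refine h.bowenMeasure_eq_zero hc ?_ ?_ (hY U hU hKU)
    · exact_mod_cast add_pos_of_nonneg_of_pos t.2 hε
    · exact_mod_cast add_lt_add_right (half_lt_self hε) t
  refine iInf₂_le_of_le (t + ε) (add_pos_of_nonneg_of_pos t.2 hε) (iInf_le_of_le h2 ?_)
  simp

lemma bowenEntropy_mono {X : Type*} [TopologicalSpace X] (f : X → X) {Y Z : Set X} (h : Y ⊆ Z) :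
    bowenEntropy f Y ≤ bowenEntropy f Z := by
  refine iSup_mono fun 𝒜 => iSup_mono fun _ => iSup_mono fun _ => iSup_mono fun _ => ?_
  refine iInf_mono fun s => iInf_mono fun _ => iInf_mono' fun hs => ⟨?_, le_rfl⟩
  refine le_antisymm (le_trans (iSup_mono fun ε => iSup_mono fun _ => ?_) hs.le) bot_le
  exact iInf_mono fun E => iInf_mono' fun hE => ⟨h.trans hE, le_rfl⟩

/-- Lower and upper limits give the same entropy, because `h_μ(f) = h_top(f, G_μ)` is bounded by the
former. -/
lemma ksEntropyLower_eq_ksEntropy {X : Type*} [MetricSpace X]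
    [CompactSpace X] [Nonempty X] [MeasurableSpace X] [BorelSpace X] {f : X → X}
    (hf : Continuous f) (h_sat : SaturatedProperty f) {μ : ProbabilityMeasure X}
    (hμ : μ ∈ invariantMeasures f) :
    ksEntropyLower f (μ : Measure X) = ksEntropy f (μ : Measure X) := by
  refine le_antisymm (ksEntropyLower_le_ksEntropy f _) ?_
  rw [← (h_sat μ hμ).2]
  refine bowenEntropy_le_of_isCompact hf (isCompact_singleton (x := μ))
    (singleton_subset_iff.2 hμ) (by rintro _ rfl; exact le_rfl) fun U hU hμU x hx => ?_
  exact hx (hU.mem_nhds (singleton_subset_iff.1 hμU))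

/-! ### Concavity of the metric entropy -/

lemma negMulLog_sum_le {ι : Type*} {s : Finset ι} {x : ι → ℝ} (hx : ∀ i ∈ s, 0 ≤ x i) :
    Real.negMulLog (∑ i ∈ s, x i) ≤ ∑ i ∈ s, Real.negMulLog (x i) := by
  rw [Real.negMulLog, ← Finset.sum_neg_distrib, Finset.sum_mul]
  refine Finset.sum_le_sum fun i hi => ?_
  rcases (hx i hi).eq_or_lt with h | h
  · simp [← h]
  · have h1 : Real.log (x i) ≤ Real.log (∑ i ∈ s, x i) :=
      Real.log_le_log h (Finset.single_le_sum hx hi)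
    rw [Real.negMulLog]
    nlinarith

lemma partitionEntropy_nonneg {X ι : Type*} [MeasurableSpace X] [Fintype ι] (μ : Measure X)
    [IsProbabilityMeasure μ] (ζ : X → ι) : 0 ≤ partitionEntropy μ ζ :=
  Finset.sum_nonneg fun _ _ => Real.negMulLog_nonneg measureReal_nonneg measureReal_le_one

/-- A finer partition has larger entropy. -/
lemma partitionEntropy_comp_le {X ι κ : Type*} [MeasurableSpace X] [Fintype ι] [Fintype κ]
    [MeasurableSpace ι] [MeasurableSingletonClass ι] (μ : Measure X) [IsFiniteMeasure μ]
    {ζ : X → ι} (hζ : Measurable ζ) (g : ι → κ) :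
    partitionEntropy μ (g ∘ ζ) ≤ partitionEntropy μ ζ := by
  classical
  have h1 : ∀ j, μ.real (g ∘ ζ ⁻¹' {j})
      = ∑ i ∈ Finset.univ.filter fun i => g i = j, μ.real (ζ ⁻¹' {i}) := by
    intro j
    rw [sum_measureReal_fibre μ hζ]
    congr 1
    ext x
    simp
  calc partitionEntropy μ (g ∘ ζ)
      ≤ ∑ j, ∑ i ∈ Finset.univ.filter fun i => g i = j, Real.negMulLog (μ.real (ζ ⁻¹' {i})) := by
        refine Finset.sum_le_sum fun j _ => ?_
        rw [h1]
        exact negMulLog_sum_le fun i _ => measureReal_nonneg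
    _ = partitionEntropy μ ζ :=
        Finset.sum_fiberwise Finset.univ g fun i => Real.negMulLog (μ.real (ζ ⁻¹' {i}))

lemma partitionEntropy_concave {X ι : Type*} [MeasurableSpace X] [Fintype ι] (μ ν : Measure X)
    [IsFiniteMeasure μ] [IsFiniteMeasure ν] {a b : ℝ≥0} (hab : a + b = 1) (ζ : X → ι) :
    a * partitionEntropy μ ζ + b * partitionEntropy ν ζ
      ≤ partitionEntropy (a • μ + b • ν) ζ := by
  rw [partitionEntropy, partitionEntropy, Finset.mul_sum, Finset.mul_sum,
    ← Finset.sum_add_distrib]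
  refine Finset.sum_le_sum fun i _ => ?_
  rw [measureReal_add_apply, measureReal_nnreal_smul_apply, measureReal_nnreal_smul_apply]
  exact Real.concaveOn_negMulLog.2 measureReal_nonneg measureReal_nonneg a.2 b.2
    (by exact_mod_cast hab)

lemma liminf_add_liminf_le (u v : ℕ → ℝ≥0∞) :
    liminf u atTop + liminf v atTop ≤ liminf (fun n => u n + v n) atTop := by
  simp_rw [liminf_eq_iSup_iInf_of_nat]
  refine ENNReal.iSup_add_iSup_le fun m n => le_iSup_of_le (max m n) ?_
  refine le_iInf₂ fun i hi => add_le_add ?_ ?_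
  · exact iInf₂_le i ((le_max_left m n).trans hi)
  · exact iInf₂_le i ((le_max_right m n).trans hi)

/-- Concavity of the metric entropy, stated with lower limits on the left, which are superadditive;
the partitions for `μ` and for `ν` are replaced by their join. -/
lemma ksEntropyLower_concave {X : Type*} [MeasurableSpace X] {f : X → X} (hf : Measurable f)
    (μ ν : Measure X) [IsProbabilityMeasure μ] [IsProbabilityMeasure ν] {a b : ℝ≥0}
    (hab : a + b = 1) :
    a * ksEntropyLower f μ + b * ksEntropyLower f ν ≤ ksEntropy f (a • μ + b • ν) := by
  have key : ∀ (p q : Σ k : ℕ, {ξ : X → Fin k // Measurable ξ}),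
      a * liminf (fun n : ℕ => ENNReal.ofReal
          (partitionEntropy μ (itinerary f p.2.1 n) / n)) atTop
        + b * liminf (fun n : ℕ => ENNReal.ofReal
          (partitionEntropy ν (itinerary f q.2.1 n) / n)) atTop
        ≤ ksEntropy f (a • μ + b • ν) := by
    rintro ⟨k, ξ, hξ⟩ ⟨l, η, hη⟩
    have hζ : Measurable fun x => finProdFinEquiv (ξ x, η x) :=
      (measurable_of_finite _).comp (hξ.prodMk hη)
    set ζ : X → Fin (k * l) := fun x => finProdFinEquiv (ξ x, η x)
    have h1 : ∀ n, a * partitionEntropy μ (itinerary f ξ n)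
        + b * partitionEntropy ν (itinerary f η n)
        ≤ partitionEntropy (a • μ + b • ν) (itinerary f ζ n) := by
      intro n
      have hm := measurable_itinerary hf hζ n
      have hξζ : itinerary f ξ n
          = (fun w j => (finProdFinEquiv.symm (w j)).1) ∘ itinerary f ζ n := by
        funext x j
        exact congrArg Prod.fst (finProdFinEquiv.symm_apply_apply
          (ξ (f^[(j : ℕ)] x), η (f^[(j : ℕ)] x))).symm
      have hηζ : itinerary f η n
          = (fun w j => (finProdFinEquiv.symm (w j)).2) ∘ itinerary f ζ n := by
        funext x j
        exact congrArg Prod.snd (finProdFinEquiv.symm_apply_apply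
          (ξ (f^[(j : ℕ)] x), η (f^[(j : ℕ)] x))).symm
      refine le_trans (add_le_add ?_ ?_) (partitionEntropy_concave μ ν hab _)
      · rw [hξζ]
        exact mul_le_mul_of_nonneg_left (partitionEntropy_comp_le μ hm _) a.2
      · rw [hηζ]
        exact mul_le_mul_of_nonneg_left (partitionEntropy_comp_le ν hm _) b.2
    refine le_trans ?_ (le_iSup_of_le (k * l) (le_iSup_of_le ζ (le_iSup_of_le hζ le_rfl)))
    rw [← ENNReal.liminf_const_mul_of_ne_top ENNReal.coe_ne_top,
      ← ENNReal.liminf_const_mul_of_ne_top ENNReal.coe_ne_top]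
    refine (liminf_add_liminf_le _ _).trans (le_trans (liminf_le_limsup) (limsup_le_limsup ?_))
    refine Eventually.of_forall fun n => ?_
    beta_reduce
    rw [← ENNReal.ofReal_coe_nnreal, ← ENNReal.ofReal_coe_nnreal, ← ENNReal.ofReal_mul a.coe_nonneg,
      ← ENNReal.ofReal_mul b.coe_nonneg, ← ENNReal.ofReal_add]
    · refine ENNReal.ofReal_le_ofReal ?_
      rw [← mul_div_assoc, ← mul_div_assoc, ← add_div]
      exact div_le_div_of_nonneg_right (h1 n) (Nat.cast_nonneg n)
    · exact mul_nonneg a.coe_nonneg (div_nonneg (partitionEntropy_nonneg μ _) (Nat.cast_nonneg n))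
    · exact mul_nonneg b.coe_nonneg (div_nonneg (partitionEntropy_nonneg ν _) (Nat.cast_nonneg n))
  have hL : ∀ m : Measure X, ksEntropyLower f m
      = ⨆ p : Σ k : ℕ, {ξ : X → Fin k // Measurable ξ}, liminf (fun n : ℕ =>
        ENNReal.ofReal (partitionEntropy m (itinerary f p.2.1 n) / n)) atTop := by
    intro m
    rw [iSup_sigma]
    simp_rw [iSup_subtype]
    rfl
  have : Nonempty (Σ k : ℕ, {ξ : X → Fin k // Measurable ξ}) :=
    ⟨⟨1, fun _ => 0, measurable_const⟩⟩
  rw [hL μ, hL ν, ENNReal.mul_iSup, ENNReal.mul_iSup]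
  exact ENNReal.iSup_add_iSup_le key

lemma ksEntropy_concave {X : Type*} [MetricSpace X] [CompactSpace X] [Nonempty X]
    [MeasurableSpace X] [BorelSpace X] {f : X → X} (hf : Continuous f)
    (h_sat : SaturatedProperty f) {μ ν : ProbabilityMeasure X} (hμ : μ ∈ invariantMeasures f)
    (hν : ν ∈ invariantMeasures f) {a b : ℝ≥0} (hab : a + b = 1) :
    a * ksEntropy f (μ : Measure X) + b * ksEntropy f (ν : Measure X)
      ≤ ksEntropy f (a • (μ : Measure X) + b • (ν : Measure X)) := by
  rw [← ksEntropyLower_eq_ksEntropy hf h_sat hμ, ← ksEntropyLower_eq_ksEntropy hf h_sat hν]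
  exact ksEntropyLower_concave hf.measurable _ _ hab

/-! ### The compact convex set of invariant measures -/

lemma exists_invariantMeasure_eq_convex_comb {X : Type*} [MeasurableSpace X] {f : X → X}
    {μ ν : ProbabilityMeasure X} (hμ : μ ∈ invariantMeasures f) (hν : ν ∈ invariantMeasures f)
    {a b : ℝ≥0} (hab : a + b = 1) :
    ∃ m ∈ invariantMeasures f, (m : Measure X) = a • (μ : Measure X) + b • (ν : Measure X) := by
  refine ⟨⟨a • (μ : Measure X) + b • (ν : Measure X), ⟨?_⟩⟩, ⟨hμ.measurable, ?_⟩, rfl⟩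
  · simp only [Measure.coe_add, Measure.coe_nnreal_smul_apply, Pi.add_apply, measure_univ, mul_one]
    exact_mod_cast hab
  · have h1 : Measure.map f (μ : Measure X) = μ := hμ.map_eq
    have h2 : Measure.map f (ν : Measure X) = ν := hν.map_eq
    simp [Measure.map_add _ _ hμ.measurable, Measure.map_smul, h1, h2]

lemma isClosed_invariantMeasures {X : Type*} [MetricSpace X] [MeasurableSpace X] [BorelSpace X]
    {f : X → X} (hf : Continuous f) : IsClosed (invariantMeasures f) := by
  have h1 : invariantMeasures f
      = {μ : ProbabilityMeasure X | μ.map hf.measurable.aemeasurable = μ} := by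
    ext μ
    refine ⟨fun h => Subtype.ext h.map_eq, fun h => ⟨hf.measurable, congrArg Subtype.val h⟩⟩
  rw [h1]
  exact isClosed_eq (ProbabilityMeasure.continuous_map hf) continuous_id

section Compact

variable {X : Type*} [MetricSpace X] [CompactSpace X] [MeasurableSpace X] [BorelSpace X]
  {f : X → X}

lemma continuous_integral_probabilityMeasure (φ : C(X, ℝ)) :
    Continuous fun μ : ProbabilityMeasure X => ∫ x, φ x ∂(μ : Measure X) :=
  ProbabilityMeasure.continuous_integral_boundedContinuousFunction
    (BoundedContinuousFunction.mkOfCompact φ)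

/-- The Krylov–Bogoliubov argument: limits of empirical measures are invariant. -/
lemma exists_invariantMeasure_tendsto_empiricalMeasure (hf : Continuous f) (x : X)
    (u : Ultrafilter ℕ) (hu : (u : Filter ℕ) ≤ atTop) :
    ∃ μ ∈ invariantMeasures f, Tendsto (empiricalMeasure f x) u (𝓝 μ) := by
  obtain ⟨μ, hμ⟩ : ∃ μ, Tendsto (empiricalMeasure f x) u (𝓝 μ) :=
    ⟨_, (u.map (empiricalMeasure f x)).le_nhds_lim⟩
  refine ⟨μ, ⟨hf.measurable, ?_⟩, hμ⟩
  have : IsProbabilityMeasure (Measure.map f (μ : Measure X)) :=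
    Measure.isProbabilityMeasure_map hf.measurable.aemeasurable
  refine ext_of_forall_integral_eq_of_IsFiniteMeasure fun g => ?_
  rw [integral_map hf.measurable.aemeasurable g.continuous.aestronglyMeasurable]
  have h1 := ProbabilityMeasure.tendsto_iff_forall_integral_tendsto.1 hμ
  have h2 := (h1 (g.compContinuous ⟨f, hf⟩)).sub (h1 g)
  -- the two averages differ only by boundary terms
  have h3 : Tendsto (fun N =>
      ∫ y, (g.compContinuous ⟨f, hf⟩) y ∂(empiricalMeasure f x N : Measure X)
      - ∫ y, g y ∂(empiricalMeasure f x N : Measure X)) atTop (𝓝 0) := by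
    refine squeeze_zero_norm (a := fun N : ℕ => 2 * ‖g‖ * (1 / ((N : ℝ) + 1))) (fun N => ?_) ?_
    · rw [integral_empiricalMeasure, integral_empiricalMeasure, ← sub_div,
        ← Finset.sum_sub_distrib]
      have h4 : ∑ k ∈ Finset.range (N + 1),
          ((g.compContinuous ⟨f, hf⟩) (f^[k] x) - g (f^[k] x)) = g (f^[N + 1] x) - g x := by
        refine Eq.trans ?_ (Finset.sum_range_sub (fun k => g (f^[k] x)) (N + 1))
        refine Finset.sum_congr rfl fun k _ => ?_
        rw [Function.iterate_succ_apply']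
        rfl
      have hN : (0 : ℝ) < (N : ℝ) + 1 := by positivity
      rw [h4, norm_div, Real.norm_of_nonneg hN.le, mul_one_div]
      refine div_le_div_of_nonneg_right ?_ hN.le
      calc ‖g (f^[N + 1] x) - g x‖ ≤ ‖g (f^[N + 1] x)‖ + ‖g x‖ := norm_sub_le _ _
        _ ≤ 2 * ‖g‖ := by linarith [g.norm_coe_le_norm (f^[N + 1] x), g.norm_coe_le_norm x]
    · simpa using tendsto_one_div_add_atTop_nhds_zero_nat.const_mul (2 * ‖g‖)
  exact sub_eq_zero.1 (tendsto_nhds_unique h2 (h3.mono_left hu))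

/-! ### The entropy spectrum as a maximum of metric entropies -/

lemma mem_levelSet_iff {φ : C(X, ℝ)} {α : ℝ} {x : X} :
    x ∈ levelSet f φ α ↔
      Tendsto (fun N => ∫ y, φ y ∂(empiricalMeasure f x N : Measure X)) atTop (𝓝 α) := by
  rw [levelSet, mem_ofPred_eq, ← tendsto_add_atTop_iff_nat 1]
  refine tendsto_congr fun N => ?_
  rw [integral_empiricalMeasure, birkhoffAverage, birkhoffSum, smul_eq_mul, div_eq_inv_mul]
  push_cast
  rfl

lemma genericSet_subset_levelSet (φ : C(X, ℝ)) (μ : ProbabilityMeasure X) :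
    genericSet f μ ⊆ levelSet f φ (∫ x, φ x ∂(μ : Measure X)) := fun _ hx =>
  mem_levelSet_iff.2 (((continuous_integral_probabilityMeasure φ).tendsto μ).comp hx)

lemma exists_invariantMeasure_of_mem_levelSet (hf : Continuous f) {φ : C(X, ℝ)} {α : ℝ} {x : X}
    (hx : x ∈ levelSet f φ α) (u : Ultrafilter ℕ) (hu : (u : Filter ℕ) ≤ atTop) :
    ∃ μ ∈ invariantMeasures f, ∫ y, φ y ∂(μ : Measure X) = α ∧
      Tendsto (empiricalMeasure f x) u (𝓝 μ) := by
  obtain ⟨μ, hμf, hμ⟩ := exists_invariantMeasure_tendsto_empiricalMeasure hf x u hu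
  refine ⟨μ, hμf, ?_, hμ⟩
  exact tendsto_nhds_unique (((continuous_integral_probabilityMeasure φ).tendsto μ).comp hμ)
    ((mem_levelSet_iff.1 hx).mono_left hu)

lemma rotationSet_eq_image (hf : Continuous f) (h_sat : SaturatedProperty f) (φ : C(X, ℝ)) :
    rotationSet f φ
      = (fun μ : ProbabilityMeasure X => ∫ x, φ x ∂(μ : Measure X)) '' invariantMeasures f := by
  ext α
  constructor
  · rintro ⟨x, hx⟩
    obtain ⟨μ, hμf, hμ, -⟩ := exists_invariantMeasure_of_mem_levelSet hf hx
      (Ultrafilter.of atTop) (Ultrafilter.of_le _)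
    exact ⟨μ, hμf, hμ⟩
  · rintro ⟨μ, hμf, rfl⟩
    exact (h_sat μ hμf).1.mono (genericSet_subset_levelSet φ μ)

lemma ksEntropy_le_entropySpectrum (h_sat : SaturatedProperty f) (φ : C(X, ℝ))
    {μ : ProbabilityMeasure X} (hμ : μ ∈ invariantMeasures f) :
    ksEntropy f (μ : Measure X) ≤ entropySpectrum f φ (∫ x, φ x ∂(μ : Measure X)) := by
  rw [← (h_sat μ hμ).2]
  exact bowenEntropy_mono f (genericSet_subset_levelSet φ μ)

/-- The conditional variational principle, with an attained maximum: together with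
`ksEntropy_le_entropySpectrum` it says that the spectrum at `α` is the maximum of the entropies of
the invariant measures with integral `α`. -/
lemma exists_ksEntropy_eq_entropySpectrum [Nonempty X] (hf : Continuous f)
    (h_usc : UpperSemicontinuousOn
      (fun μ : ProbabilityMeasure X => ksEntropy f (μ : Measure X)) (invariantMeasures f))
    (h_sat : SaturatedProperty f) {φ : C(X, ℝ)} {α : ℝ} (hα : α ∈ rotationSet f φ) :
    ∃ μ ∈ invariantMeasures f, ∫ x, φ x ∂(μ : Measure X) = α ∧
      ksEntropy f (μ : Measure X) = entropySpectrum f φ α := by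
  set K : Set (ProbabilityMeasure X) :=
    {μ | μ ∈ invariantMeasures f ∧ ∫ x, φ x ∂(μ : Measure X) = α} with hKdef
  have hK : IsCompact K := ((isClosed_invariantMeasures hf).inter
    (isClosed_eq (continuous_integral_probabilityMeasure φ) continuous_const)).isCompact
  have hKf : K ⊆ invariantMeasures f := fun μ hμ => hμ.1
  have hne : K.Nonempty := by
    rw [rotationSet_eq_image hf h_sat] at hα
    obtain ⟨μ, hμf, hμ⟩ := hα
    exact ⟨μ, hμf, hμ⟩
  obtain ⟨μ, hμK, hmax⟩ := (h_usc.mono hKf).exists_isMaxOn hne hK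
  refine ⟨μ, hμK.1, hμK.2, le_antisymm ?_ ?_⟩
  · conv_rhs => rw [← hμK.2]
    exact ksEntropy_le_entropySpectrum h_sat φ hμK.1
  · refine bowenEntropy_le_of_isCompact hf hK hKf
      (fun ν hν => (ksEntropyLower_le_ksEntropy f _).trans (hmax hν)) fun U hU hKU x hx => ?_
    by_contra hcon
    have hcon' : ∃ᶠ N in atTop, N ∈ {N | empiricalMeasure f x N ∉ U} := not_eventually.1 hcon
    rw [frequently_mem_iff_neBot] at hcon'
    set u := Ultrafilter.of (atTop ⊓ 𝓟 {N | empiricalMeasure f x N ∉ U})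
    have hu := le_inf_iff.1 (Ultrafilter.of_le (atTop ⊓ 𝓟 {N | empiricalMeasure f x N ∉ U}))
    obtain ⟨ν, hνf, hν, hlim⟩ := exists_invariantMeasure_of_mem_levelSet hf hx u hu.1
    have h1 : ∀ᶠ N in (u : Filter ℕ), empiricalMeasure f x N ∈ U :=
      hlim (hU.mem_nhds (hKU ⟨hνf, hν⟩))
    obtain ⟨N, hN, hN'⟩ := (h1.and (le_principal_iff.1 hu.2)).exists
    exact hN' hN

/-! ### Regularity of the spectrum -/

lemma rotationSet_nonempty [Nonempty X] (hf : Continuous f) (h_sat : SaturatedProperty f)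
    (φ : C(X, ℝ)) : (rotationSet f φ).Nonempty := by
  obtain ⟨μ, hμ, -⟩ := exists_invariantMeasure_tendsto_empiricalMeasure hf
    (Classical.arbitrary X) (Ultrafilter.of atTop) (Ultrafilter.of_le _)
  rw [rotationSet_eq_image hf h_sat]
  exact ⟨_, μ, hμ, rfl⟩

lemma integral_convex_comb (φ : C(X, ℝ)) (μ ν : ProbabilityMeasure X) (a b : ℝ≥0) :
    ∫ x, φ x ∂(a • (μ : Measure X) + b • (ν : Measure X))
      = a • ∫ x, φ x ∂(μ : Measure X) + b • ∫ x, φ x ∂(ν : Measure X) := by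
  have h : ∀ m : Measure X, IsFiniteMeasure m → Integrable φ m := fun m _ =>
    φ.continuous.integrable_of_hasCompactSupport (HasCompactSupport.of_compactSpace _)
  rw [integral_add_measure (h _ inferInstance) (h _ inferInstance),
    integral_smul_nnreal_measure, integral_smul_nnreal_measure]

lemma concaveOn_entropySpectrum [Nonempty X] (hf : Continuous f)
    (h_usc : UpperSemicontinuousOn
      (fun μ : ProbabilityMeasure X => ksEntropy f (μ : Measure X)) (invariantMeasures f))
    (h_sat : SaturatedProperty f) (φ : C(X, ℝ)) :
    ConcaveOn ℝ≥0 (rotationSet f φ) (entropySpectrum f φ) := by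
  have key : ∀ ⦃α⦄, α ∈ rotationSet f φ → ∀ ⦃β⦄, β ∈ rotationSet f φ → ∀ ⦃a b : ℝ≥0⦄,
      a + b = 1 → a • α + b • β ∈ rotationSet f φ ∧
        a • entropySpectrum f φ α + b • entropySpectrum f φ β
          ≤ entropySpectrum f φ (a • α + b • β) := by
    intro α hα β hβ a b hab
    obtain ⟨μ, hμf, rfl, hμ⟩ := exists_ksEntropy_eq_entropySpectrum hf h_usc h_sat hα
    obtain ⟨ν, hνf, rfl, hν⟩ := exists_ksEntropy_eq_entropySpectrum hf h_usc h_sat hβ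
    obtain ⟨m, hmf, hm⟩ := exists_invariantMeasure_eq_convex_comb hμf hνf hab
    have h1 := ksEntropy_le_entropySpectrum h_sat φ hmf
    rw [hm, integral_convex_comb] at h1
    refine ⟨?_, le_trans ?_ h1⟩
    · rw [rotationSet_eq_image hf h_sat]
      exact ⟨m, hmf, by simp only [hm, integral_convex_comb]⟩
    · rw [← hμ, ← hν]
      exact ksEntropy_concave hf h_sat hμf hνf hab
  exact ⟨fun α hα β hβ a b _ _ hab => (key hα hβ hab).1,
    fun α hα β hβ a b _ _ hab => (key hα hβ hab).2⟩

lemma exists_rotationSet_eq_Icc [Nonempty X] (hf : Continuous f)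
    (h_sat : SaturatedProperty f) (φ : C(X, ℝ)) :
    ∃ a b : ℝ, a ≤ b ∧ rotationSet f φ = Icc a b := by
  have hcomp : IsCompact (rotationSet f φ) := by
    rw [rotationSet_eq_image hf h_sat]
    exact (isClosed_invariantMeasures hf).isCompact.image
      (continuous_integral_probabilityMeasure φ)
  have hconv : Convex ℝ (rotationSet f φ) := by
    intro α hα β hβ a b ha hb hab
    rw [rotationSet_eq_image hf h_sat] at hα hβ ⊢
    obtain ⟨μ, hμf, rfl⟩ := hα
    obtain ⟨ν, hνf, rfl⟩ := hβ
    lift a to ℝ≥0 using ha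
    lift b to ℝ≥0 using hb
    obtain ⟨m, hmf, hm⟩ := exists_invariantMeasure_eq_convex_comb hμf hνf
      (show a + b = 1 by exact_mod_cast hab)
    exact ⟨m, hmf, by simp only [hm, integral_convex_comb]; rfl⟩
  have hne := rotationSet_nonempty hf h_sat φ
  have h := eq_Icc_of_connected_compact ⟨hne, hconv.isPreconnected⟩ hcomp
  exact ⟨_, _, nonempty_Icc.1 (h ▸ hne), h⟩

/-- Upper semicontinuity passes from the entropy map to the spectrum by compactness. -/
lemma eventually_entropySpectrum_lt [Nonempty X] (hf : Continuous f)
    (h_usc : UpperSemicontinuousOn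
      (fun μ : ProbabilityMeasure X => ksEntropy f (μ : Measure X)) (invariantMeasures f))
    (h_sat : SaturatedProperty f) (φ : C(X, ℝ)) {α₀ : ℝ} {y : ℝ≥0∞}
    (hy : entropySpectrum f φ α₀ < y) :
    ∀ᶠ α in 𝓝[rotationSet f φ] α₀, entropySpectrum f φ α < y := by
  by_contra hcon
  have hcon' : ∃ᶠ α in 𝓝[rotationSet f φ] α₀, α ∈ {α | ¬ entropySpectrum f φ α < y} :=
    not_eventually.1 hcon
  rw [frequently_mem_iff_neBot] at hcon'
  have : Nonempty (ProbabilityMeasure X) := ⟨empiricalMeasure f (Classical.arbitrary X) 0⟩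
  choose! g hgf hgφ hg using fun α (hα : α ∈ rotationSet f φ) =>
    exists_ksEntropy_eq_entropySpectrum hf h_usc h_sat hα
  set u := Ultrafilter.of (𝓝[rotationSet f φ] α₀ ⊓ 𝓟 {α | ¬ entropySpectrum f φ α < y})
  have hu := le_inf_iff.1
    (Ultrafilter.of_le (𝓝[rotationSet f φ] α₀ ⊓ 𝓟 {α | ¬ entropySpectrum f φ α < y}))
  have huR : ∀ᶠ α in (u : Filter ℝ), α ∈ rotationSet f φ := hu.1 self_mem_nhdsWithin
  obtain ⟨μ, hμ⟩ : ∃ μ, Tendsto g u (𝓝 μ) := ⟨_, (u.map g).le_nhds_lim⟩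
  have hgu : ∀ᶠ α in (u : Filter ℝ), g α ∈ invariantMeasures f := huR.mono hgf
  have hμf : μ ∈ invariantMeasures f := (isClosed_invariantMeasures hf).mem_of_tendsto hμ hgu
  have hμφ : ∫ x, φ x ∂(μ : Measure X) = α₀ := by
    refine tendsto_nhds_unique (((continuous_integral_probabilityMeasure φ).tendsto μ).comp hμ) ?_
    refine Tendsto.congr' (huR.mono fun α hα => (hgφ α hα).symm) ?_
    exact hu.1.trans nhdsWithin_le_nhds
  have hlt : ksEntropy f (μ : Measure X) < y := by
    refine lt_of_le_of_lt ?_ hy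
    rw [← hμφ]
    exact ksEntropy_le_entropySpectrum h_sat φ hμf
  have h1 : ∀ᶠ α in (u : Filter ℝ), ksEntropy f (g α : Measure X) < y :=
    (tendsto_nhdsWithin_iff.2 ⟨hμ, hgu⟩).eventually (h_usc μ hμf y hlt)
  obtain ⟨α, ⟨hα1, hα2⟩, hα3⟩ := ((h1.and huR).and (le_principal_iff.1 hu.2)).exists
  exact hα3 (hg α hα2 ▸ hα1)

end Compact

/-- A concave function on a compact interval is lower semicontinuous, also at the endpoints: for
`c < 1` the image of the interval under the homothety with centre `α₀` and ratio `1 - c` is a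
neighbourhood of `α₀` in the interval, and `F ≥ c * F α₀` there. -/
lemma ConcaveOn.eventually_lt_of_Icc {a b : ℝ} {F : ℝ → ℝ≥0∞} (hF : ConcaveOn ℝ≥0 (Icc a b) F)
    {α₀ : ℝ} (hα₀ : α₀ ∈ Icc a b) {y : ℝ≥0∞} (hy : y < F α₀) :
    ∀ᶠ α in 𝓝[Icc a b] α₀, y < F α := by
  obtain ⟨c, hc1, hc⟩ : ∃ c : ℝ≥0, c < 1 ∧ y < c * F α₀ := by
    have h1 : Tendsto (fun c : ℝ≥0 => (c : ℝ≥0∞) * F α₀) (𝓝[<] 1) (𝓝 (1 * F α₀)) := by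
      refine ENNReal.Tendsto.mul_const ?_ (Or.inl one_ne_zero)
      exact (ENNReal.tendsto_coe.2 tendsto_id).mono_left nhdsWithin_le_nhds
    rw [one_mul] at h1
    have : (𝓝[<] (1 : ℝ≥0)).NeBot := nhdsLT_neBot_of_exists_lt ⟨0, zero_lt_one⟩
    exact ((eventually_mem_nhdsWithin (s := Iio (1 : ℝ≥0))).and
      (h1.eventually_const_lt hy)).exists
  have hd : (0 : ℝ) < 1 - c := sub_pos.2 (by exact_mod_cast hc1)
  have hlim : Tendsto (fun α => (α - c * α₀) / (1 - c)) (𝓝 α₀) (𝓝 α₀) := by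
    have h1 : ContinuousAt (fun α => (α - c * α₀) / (1 - c)) α₀ := by fun_prop
    have h2 : (α₀ - c * α₀) / (1 - c) = α₀ := by field_simp
    simpa [ContinuousAt, h2] using h1
  have hmem : ∀ᶠ α in 𝓝[Icc a b] α₀, (α - c * α₀) / (1 - c) ∈ Icc a b := by
    have hl : ∀ᶠ α in 𝓝[Icc a b] α₀, a ≤ (α - c * α₀) / (1 - c) := by
      rcases hα₀.1.eq_or_lt with h | h
      · filter_upwards [self_mem_nhdsWithin] with α hα
        rw [le_div_iff₀ hd, ← h]
        linarith [hα.1]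
      · exact ((hlim.eventually_const_lt h).filter_mono nhdsWithin_le_nhds).mono fun _ => le_of_lt
    have hr : ∀ᶠ α in 𝓝[Icc a b] α₀, (α - c * α₀) / (1 - c) ≤ b := by
      rcases hα₀.2.eq_or_lt with h | h
      · filter_upwards [self_mem_nhdsWithin] with α hα
        rw [div_le_iff₀ hd, h]
        linarith [hα.2]
      · exact ((hlim.eventually_lt_const h).filter_mono nhdsWithin_le_nhds).mono fun _ => le_of_lt
    exact hl.and hr
  filter_upwards [hmem] with α hα
  have h1 := hF.2 hα₀ hα zero_le zero_le (add_tsub_cancel_of_le hc1.le)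
  have h2 : c • α₀ + (1 - c) • ((α - c * α₀) / (1 - c)) = α := by
    rw [NNReal.smul_def, NNReal.smul_def, NNReal.coe_sub hc1.le, smul_eq_mul, smul_eq_mul,
      NNReal.coe_one, mul_div_cancel₀ _ hd.ne']
    ring
  rw [h2] at h1
  exact hc.trans_le (le_trans (le_add_of_nonneg_right zero_le) h1)

theorem mainTheorem6 {X : Type*} [MetricSpace X] [CompactSpace X] [Nonempty X]
    [MeasurableSpace X] [BorelSpace X] (f : X → X) (hf : Continuous f)
    (h_usc : UpperSemicontinuousOn
      (fun μ : ProbabilityMeasure X => ksEntropy f (μ : Measure X)) (invariantMeasures f))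
    (h_sat : SaturatedProperty f) (φ : C(X, ℝ)) :
    (∃ a b : ℝ, a ≤ b ∧ rotationSet f φ = Icc a b) ∧
    ContinuousOn (entropySpectrum f φ) (rotationSet f φ) ∧
    ConcaveOn ℝ≥0 (rotationSet f φ) (entropySpectrum f φ) ∧
    (∀ m : ProbabilityMeasure X, IsMaxEntropyMeasure f m →
      (∀ μ : ProbabilityMeasure X, IsMaxEntropyMeasure f μ → μ = m) →
      (∫ x, φ x ∂(m : Measure X)) ∈ rotationSet f φ ∧
      entropySpectrum f φ (∫ x, φ x ∂(m : Measure X)) = topEntropy f ∧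
      ∀ α ∈ rotationSet f φ, α ≠ (∫ x, φ x ∂(m : Measure X)) →
        entropySpectrum f φ α < topEntropy f) := by
  obtain ⟨a, b, hab, hR⟩ := exists_rotationSet_eq_Icc hf h_sat φ
  have hconc := concaveOn_entropySpectrum hf h_usc h_sat φ
  refine ⟨⟨a, b, hab, hR⟩, fun α₀ hα₀ => tendsto_order.2 ⟨fun y hy => ?_, fun y hy => ?_⟩, hconc,
    fun m hm hunique => ?_⟩
  · rw [hR] at hα₀ hconc ⊢
    exact hconc.eventually_lt_of_Icc hα₀ hy
  · exact eventually_entropySpectrum_lt hf h_usc h_sat φ hy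
  · have hle : ∀ α, entropySpectrum f φ α ≤ topEntropy f := fun α =>
      bowenEntropy_mono f (subset_univ _)
    refine ⟨?_, le_antisymm (hle _) ?_, fun α hα hne => (hle α).lt_of_ne fun heq => hne ?_⟩
    · rw [rotationSet_eq_image hf h_sat]
      exact ⟨m, hm.1, rfl⟩
    · rw [← hm.2]
      exact ksEntropy_le_entropySpectrum h_sat φ hm.1
    · obtain ⟨μ, hμf, hμφ, hμ⟩ := exists_ksEntropy_eq_entropySpectrum hf h_usc h_sat hα
      rw [← hunique μ ⟨hμf, hμ.trans heq⟩, hμφ]
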